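/- Consider a periodic soft real-time task $\tau$ with period $T>0$, relative deadline $D>0$ and relative dismiss point $\delta\ge 0$. Its jobs $J_1,J_2,\dots$ have random execution times $C_1,C_2,\dots$; job $J_j$ is released at time $(j-1)T$, has absolute deadline $(j-1)T+D$, and is dismissed at time $(j-1)T+D+\delta$ if it is not finished by then. The jobs are served first-come-first-serve by a greedy processing component whose accumulative service $\beta_j(t)$ in $[(j-1)T,(j-1)T+t)$, $0\le t\le T$, satisfies $\beta_j(0)=0$, is non-decreasing in $t$, and satisfies $\beta_j(t+\varepsilon)\le\beta_j(t)+\varepsilon$ for $\varepsilon>0$, $t+\varepsilon\le T$. Let $\mathrm{DM}(j)=1$ if $J_j$ is not finished by its absolute deadline, $\mathrm{DM}(j)=0$ otherwise, and $\mathrm{DMR}_N=\frac1N\sum_{j=1}^N\mathrm{DM}(j)$. A constant $d\in\mathbb{R}$ is called the deadline miss rate of $\tau$, written $\mathrm{DMR}=d$, if $\mathbb{P}(\lim_{N\to\infty}\mathrm{DMR}_N=d)=1$. Let $X_\bullet=(X_n)_{n\ge 1}$ be a time-homogeneous Markov chain, on the same probability space, with state space $S$, an arbitrary initial distribution, and column-stochastic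 transition matrix $P=(P_{r,s})_{r,s\in S}$, where $P_{r,s}$ is the probability of moving from $s$ to $r$. Let $X_j$ indicate the state of job $J_j$, and let $S_{\mathrm{DM}}\subseteq S$ be the set of states that indicate a deadline miss, i.e. for every $j$, almost surely, $X_j\in S_{\mathrm{DM}}$ if and only if $J_j$ misses its deadline. If $S$ is finite and $X_\bullet$ is irreducible, then there is a unique stationary distribution $\pi$, i.e. a unique probability vector $\pi=(\pi_s)_{s\in S}$ with $P\pi=\pi$. Moreover, $$\mathbb{P}\Big(\lim_{N\to\infty}\mathrm{DMR}_N=\sum_{s\in S_{\mathrm{DM}}}\pi_s\Big)=1,$$ and therefore the deadline miss rate exists, is unique, and equals $\mathrm{DMR}=\sum_{s\in S_{\mathrm{DM}}}\pi_s$. -/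

import Mathlib

open MeasureTheory ProbabilityTheory Filter Topology

/-- A periodic soft real-time task: period `T`, relative deadline `D` and relative dismiss point
`δ` after a deadline miss.  No relation between `D` and `T` is assumed. -/
structure PeriodicTask where
  T : ℝ
  D : ℝ
  δ : ℝ
  T_pos : 0 < T
  D_pos : 0 < D
  δ_nonneg : 0 ≤ δ

/-- The accumulative service of a greedy processing component: `β j t` is the amount of service
provided in `[j T, j T + t)`, for `0 ≤ t ≤ T`.  Periods are numbered from `0`. -/
structure SupplyFunction (T : ℝ) where
  β : ℕ → ℝ → ℝ
  zero : ∀ j, β j 0 = 0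
  mono : ∀ j, MonotoneOn (β j) (Set.Icc 0 T)
  rate_le_one : ∀ j t ε, 0 ≤ t → 0 < ε → t + ε ≤ T → β j (t + ε) ≤ β j t + ε

namespace SupplyFunction

/-- The accumulative service provided in `[j T, j T + t)`, for any `t ≥ 0`. -/
noncomputable def service {T : ℝ} (B : SupplyFunction T) (j : ℕ) (t : ℝ) : ℝ :=
  (∑ l ∈ Finset.range ⌊t / T⌋₊, B.β (j + l) T) + B.β (j + ⌊t / T⌋₊) (t - T * ⌊t / T⌋₊)

/-- The accumulative service provided in `[0, t)`. -/
noncomputable def supplied {T : ℝ} (B : SupplyFunction T) (t : ℝ) : ℝ :=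
  B.service 0 t

end SupplyFunction

namespace PeriodicTask

/- Jobs are numbered from `0`: the job with index `j` is the `(j+1)`-st job of the task. -/

/-- The release time of the job with index `j`. -/
def release (τ : PeriodicTask) (j : ℕ) : ℝ := j * τ.T

/-- The absolute deadline of the job with index `j`. -/
def deadline (τ : PeriodicTask) (j : ℕ) : ℝ := τ.release j + τ.D

/-- The absolute dismiss point of the job with index `j`. -/
def dismissPoint (τ : PeriodicTask) (j : ℕ) : ℝ := τ.release j + τ.D + τ.δ

/-- The time at which a job with index `j` and execution time `c` leaves the system if it is at the
head of the queue from time `s` on: the first time at which it has received `c` units of service or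
its dismiss point is reached. -/
noncomputable def departureFrom (τ : PeriodicTask) (B : SupplyFunction τ.T) (j : ℕ) (c s : ℝ) : ℝ :=
  sInf {t : ℝ | s ≤ t ∧ (c ≤ B.supplied t - B.supplied s ∨ τ.dismissPoint j ≤ t)}

/-- The time from which on the job with index `j` is at the head of the first-come-first-serve
queue: it is released, and all earlier jobs are finished or dismissed.  Here `c j` is the execution
time of the job with index `j`. -/
noncomputable def headTime (τ : PeriodicTask) (B : SupplyFunction τ.T) (c : ℕ → ℝ) : ℕ → ℝ
  | 0 => τ.release 0
  | j + 1 => max (τ.release (j + 1)) (τ.departureFrom B j (c j) (headTime τ B c j))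

/-- The job with index `j` misses its deadline: it has not received its whole execution time by its
absolute deadline. -/
def Misses (τ : PeriodicTask) (B : SupplyFunction τ.T) (c : ℕ → ℝ) (j : ℕ) : Prop :=
  ¬ ∃ t, τ.headTime B c j ≤ t ∧ t ≤ τ.deadline j ∧
    c j ≤ B.supplied t - B.supplied (τ.headTime B c j)

open Classical in
/-- The deadline miss indicator (`1` for a miss, `0` otherwise) of the job with index `j`. -/
noncomputable def DM (τ : PeriodicTask) (B : SupplyFunction τ.T) (c : ℕ → ℝ) (j : ℕ) : ℝ :=
  if τ.Misses B c j then 1 else 0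

/-- The deadline miss rate of the first `N` jobs. -/
noncomputable def DMR (τ : PeriodicTask) (B : SupplyFunction τ.T) (c : ℕ → ℝ) (N : ℕ) : ℝ :=
  (1 / (N : ℝ)) * ∑ j ∈ Finset.range N, τ.DM B c j

/-- The constant `d` is the deadline miss rate of the task: the deadline miss rate of the first `N`
jobs converges to `d` almost surely.  `B ω` and `C j ω` are the supply and the execution time of the
job with index `j` in the outcome `ω`. -/
def IsDeadlineMissRate {Ω : Type*} [MeasurableSpace Ω] (μ : Measure Ω) (τ : PeriodicTask)
    (B : Ω → SupplyFunction τ.T) (C : ℕ → Ω → ℝ) (d : ℝ) : Prop :=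
  ∀ᵐ ω ∂μ, Tendsto (fun N => τ.DMR (B ω) (fun j => C j ω) N) atTop (𝓝 d)

end PeriodicTask

/-- `X` is a (time-homogeneous) Markov chain with finite state space `S`, initial distribution `lam`
and column-stochastic transition matrix `P`: the entry `P r s` is the probability of a transition
from `s` to `r`.  `X n` is the state of the chain at the `(n+1)`-st step. -/
structure IsMarkovChain {Ω S : Type*} [MeasurableSpace Ω] [Fintype S] [DecidableEq S]
    [MeasurableSpace S] (μ : Measure Ω) (X : ℕ → Ω → S) (lam : S → ℝ) (P : Matrix S S ℝ) :
    Prop where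
  stochastic : P ∈ Matrix.colStochastic ℝ S
  measurable : ∀ n, Measurable (X n)
  initial : ∀ s, μ.real (X 0 ⁻¹' {s}) = lam s
  transition : ∀ n r s, μ (X n ⁻¹' {s}) ≠ 0 →
    (cond μ (X n ⁻¹' {s})).real (X (n + 1) ⁻¹' {r}) = P r s
  markov : ∀ n (s : ℕ → S), μ (⋂ i ∈ Set.Iic n, X i ⁻¹' {s i}) ≠ 0 →
    (cond μ (⋂ i ∈ Set.Iic n, X i ⁻¹' {s i})).real (X (n + 1) ⁻¹' {s (n + 1)}) =
      (cond μ (X n ⁻¹' {s n})).real (X (n + 1) ⁻¹' {s (n + 1)})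

/-- `p` is a stationary (invariant) distribution of the column-stochastic matrix `P`. -/
structure IsStationaryDistribution {S : Type*} [Fintype S] (P : Matrix S S ℝ) (p : S → ℝ) :
    Prop where
  nonneg : ∀ s, 0 ≤ p s
  sum_eq_one : ∑ s, p s = 1
  invariant : P.mulVec p = p

/- Solving the Poisson equation `h - hP = f - π(f)` turns the centred sums of `f (X k)` into a
bounded boundary term plus a sum of bounded martingale increments. These are orthogonal, so their
averages tend to `0` almost surely: the averages over the first `n ^ 2` terms have summable second
moments, and by the Cauchy–Schwarz inequality so do the gaps between consecutive squares. The
equation is solvable because harmonic functions of an irreducible stochastic matrix are constant,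
and pairing it with a stationary distribution shows that `π` is the only one. -/

section StochasticMatrix

open Matrix

theorem vecMul_pow_eq_self {R S : Type*} [Semiring R] [Fintype S] [DecidableEq S]
    {M : Matrix S S R} {h : S → R} (hh : h ᵥ* M = h) (k : ℕ) : h ᵥ* M ^ k = h := by
  induction k with
  | zero => rw [pow_zero, vecMul_one]
  | succ k ih => rw [pow_succ, ← vecMul_vecMul, ih, hh]

variable {R S : Type*} [CommRing R] [LinearOrder R] [IsStrictOrderedRing R]
  [Fintype S] [DecidableEq S]

theorem eq_of_vecMul_eq_self_of_pos_of_forall_le {M : Matrix S S R} (hM : M ∈ colStochastic R S)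
    {h : S → R} (hh : h ᵥ* M = h) {m r : S} (hmax : ∀ t, h t ≤ h m) (hpos : 0 < M r m) :
    h r = h m := by
  have hsum : ∑ t, (h m - h t) * M t m = 0 := by
    have hhm : ∑ t, h t * M t m = h m := congrFun hh m
    simp only [sub_mul, Finset.sum_sub_distrib, hhm, ← Finset.mul_sum,
      sum_col_of_mem_colStochastic hM, mul_one, sub_self]
  have hzero : (h m - h r) * M r m = 0 :=
    (Finset.sum_eq_zero_iff_of_nonneg fun t _ => mul_nonneg (sub_nonneg.2 (hmax t))
      (nonneg_of_mem_colStochastic hM)).1 hsum r (Finset.mem_univ r)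
  exact (sub_eq_zero.1 ((mul_eq_zero_iff_right hpos.ne').1 hzero)).symm

theorem eq_of_vecMul_eq_self_of_isIrreducible {P : Matrix S S R} (hP : P ∈ colStochastic R S)
    (hirr : P.IsIrreducible) {h : S → R} (hh : h ᵥ* P = h) (r s : S) : h r = h s := by
  have : Nonempty S := ⟨r⟩
  obtain ⟨m, hmax⟩ := Finite.exists_max h
  suffices eq_max : ∀ t, h t = h m by rw [eq_max r, eq_max s]
  intro t
  obtain ⟨k, -, hk⟩ := (isIrreducible_iff_exists_pow_pos hirr.nonneg).1 hirr t m
  exact eq_of_vecMul_eq_self_of_pos_of_forall_le (pow_mem hP k) (vecMul_pow_eq_self hh k) hmax hk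

theorem mulVec_abs_eq_abs {M : Matrix S S R} (hM : M ∈ colStochastic R S) {v : S → R}
    (hv : M *ᵥ v = v) : M *ᵥ |v| = |v| := by
  have hle : ∀ s ∈ Finset.univ, |v| s ≤ (M *ᵥ |v|) s := fun s _ =>
    calc |v s| = |∑ t, M s t * v t| := congrArg abs (congrFun hv s).symm
      _ ≤ ∑ t, |M s t * v t| := Finset.abs_sum_le_sum_abs _ _
      _ = ∑ t, M s t * |v t| := by
          simp only [abs_mul, abs_of_nonneg (nonneg_of_mem_colStochastic hM)]
  -- `M` preserves the sum of the entries, so the entrywise inequality cannot be strict anywhere.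
  have heq := (Finset.sum_eq_sum_iff_of_le hle).1 (sum_mulVec_of_mem_colStochastic hM).symm
  exact funext fun s => (heq s (Finset.mem_univ s)).symm

theorem exists_ne_zero_mulVec_eq_self [Nonempty S] {M : Matrix S S R}
    (hM : M ∈ colStochastic R S) : ∃ v ≠ 0, M *ᵥ v = v := by
  have hdet : (M - 1).det = 0 := by
    refine exists_vecMul_eq_zero_iff.1 ⟨1, one_ne_zero, ?_⟩
    rw [vecMul_sub, one_vecMul_of_mem_colStochastic hM, vecMul_one, sub_self]
  obtain ⟨v, hv_ne, hv⟩ := exists_mulVec_eq_zero_iff.2 hdet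
  exact ⟨v, hv_ne, by rwa [sub_mulVec, one_mulVec, sub_eq_zero] at hv⟩

theorem exists_isStationaryDistribution [Nonempty S] {P : Matrix S S ℝ}
    (hP : P ∈ colStochastic ℝ S) : ∃ p, IsStationaryDistribution P p := by
  obtain ⟨v, hv_ne, hv⟩ := exists_ne_zero_mulVec_eq_self hP
  have hpos : 0 < ∑ t, |v| t := by
    obtain ⟨t, ht⟩ := Function.ne_iff.1 hv_ne
    exact Finset.sum_pos' (fun t _ => abs_nonneg _) ⟨t, Finset.mem_univ t, abs_pos.2 ht⟩
  refine ⟨(∑ t, |v| t)⁻¹ • |v|, fun s => mul_nonneg (inv_nonneg.2 hpos.le) (abs_nonneg _), ?_, ?_⟩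
  · simp only [Pi.smul_apply, smul_eq_mul, ← Finset.mul_sum]
    exact inv_mul_cancel₀ hpos.ne'
  · rw [mulVec_smul, mulVec_abs_eq_abs hP hv]

namespace IsStationaryDistribution

theorem vecMul_dotProduct {S : Type*} [Fintype S] {P : Matrix S S ℝ} {p : S → ℝ}
    (hp : IsStationaryDistribution P p) (h : S → ℝ) :
    (h ᵥ* P) ⬝ᵥ p = h ⬝ᵥ p := by
  rw [← dotProduct_mulVec, hp.invariant]

theorem one_dotProduct_eq_one {S : Type*} [Fintype S] {P : Matrix S S ℝ} {p : S → ℝ}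
    (hp : IsStationaryDistribution P p) : 1 ⬝ᵥ p = 1 := by
  rw [one_dotProduct, hp.sum_eq_one]

variable {P : Matrix S S ℝ} {p q : S → ℝ}

theorem vecMul_one_sub_add_vecMulVec_dotProduct (hp : IsStationaryDistribution P p)
    (h : S → ℝ) : (h ᵥ* (1 - P + vecMulVec p 1)) ⬝ᵥ p = h ⬝ᵥ p := by
  rw [vecMul_add, vecMul_sub, vecMul_one, vecMul_vecMulVec, add_dotProduct, sub_dotProduct,
    hp.vecMul_dotProduct, sub_self, zero_add, smul_dotProduct, hp.one_dotProduct_eq_one,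
    smul_eq_mul, mul_one]

/- The inverse of this matrix is the fundamental matrix of Kemeny and Snell. -/
theorem isUnit_one_sub_add_vecMulVec (hP : P ∈ colStochastic ℝ S) (hirr : P.IsIrreducible)
    (hp : IsStationaryDistribution P p) : IsUnit (1 - P + vecMulVec p 1) := by
  rw [isUnit_iff_isUnit_det, isUnit_iff_ne_zero, Ne, ← exists_vecMul_eq_zero_iff]
  rintro ⟨h, h_ne, hh⟩
  have hmean : h ⬝ᵥ p = 0 := by
    rw [← hp.vecMul_one_sub_add_vecMulVec_dotProduct, hh, zero_dotProduct]
  have hharm : h ᵥ* P = h := by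
    rw [vecMul_add, vecMul_sub, vecMul_one, vecMul_vecMulVec, hmean, zero_smul, add_zero,
      sub_eq_zero] at hh
    exact hh.symm
  refine h_ne (funext fun s => ?_)
  have hconst : h = h s • 1 := funext fun r => by
    simpa using eq_of_vecMul_eq_self_of_isIrreducible hP hirr hharm r s
  rwa [hconst, smul_dotProduct, hp.one_dotProduct_eq_one, smul_eq_mul, mul_one] at hmean

theorem exists_sub_vecMul_eq (hP : P ∈ colStochastic ℝ S) (hirr : P.IsIrreducible)
    (hp : IsStationaryDistribution P p) (g : S → ℝ) :
    ∃ h : S → ℝ, h - h ᵥ* P = g - (g ⬝ᵥ p) • 1 := by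
  obtain ⟨h, rfl⟩ :=
    vecMul_surjective_iff_isUnit.2 (hp.isUnit_one_sub_add_vecMulVec hP hirr) g
  refine ⟨h, ?_⟩
  dsimp only
  rw [hp.vecMul_one_sub_add_vecMulVec_dotProduct, vecMul_add, vecMul_sub, vecMul_one,
    vecMul_vecMulVec, add_sub_cancel_right]

theorem eq_of_isIrreducible (hP : P ∈ colStochastic ℝ S) (hirr : P.IsIrreducible)
    (hp : IsStationaryDistribution P p) (hq : IsStationaryDistribution P q) : q = p := by
  refine dotProduct_eq _ _ fun g => ?_
  obtain ⟨h, hh⟩ := hp.exists_sub_vecMul_eq hP hirr g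
  have hzero : (g - (g ⬝ᵥ p) • 1) ⬝ᵥ q = 0 := by
    rw [← hh, sub_dotProduct, hq.vecMul_dotProduct, sub_self]
  rw [sub_dotProduct, smul_dotProduct, hq.one_dotProduct_eq_one, smul_eq_mul, mul_one,
    sub_eq_zero] at hzero
  rw [dotProduct_comm q, dotProduct_comm p, hzero]

end IsStationaryDistribution

end StochasticMatrix

section OrthogonalStrongLaw

theorem tendsto_average_of_tendsto_squares {a : ℕ → ℝ}
    (hsq : Tendsto (fun n : ℕ => (∑ k ∈ Finset.range (n ^ 2), a k) / (n : ℝ) ^ 2) atTop (𝓝 0))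
    (hgap : Tendsto (fun n : ℕ => (∑ k ∈ Finset.Ico (n ^ 2) ((n + 1) ^ 2), |a k|) / (n : ℝ) ^ 2)
      atTop (𝓝 0)) :
    Tendsto (fun N : ℕ => (∑ k ∈ Finset.range N, a k) / N) atTop (𝓝 0) := by
  have hsqrt : Tendsto Nat.sqrt atTop atTop :=
    tendsto_atTop_atTop.2 fun b => ⟨b ^ 2, fun N hN => Nat.le_sqrt'.2 hN⟩
  have hbound := (hsq.abs.add hgap).comp hsqrt
  rw [abs_zero, add_zero] at hbound
  refine squeeze_zero_norm' ?_ hbound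
  filter_upwards [eventually_ge_atTop 1] with N hN
  dsimp only [Function.comp_apply]
  set n := N.sqrt
  have hn_pos : 0 < (n : ℝ) ^ 2 := by
    have : 0 < n := Nat.sqrt_pos.2 hN
    positivity
  have hn_le : n ^ 2 ≤ N := Nat.sqrt_le' N
  have hn_lt : N ≤ (n + 1) ^ 2 := (Nat.lt_succ_sqrt' N).le
  have hsum : |∑ k ∈ Finset.range N, a k| ≤
      |∑ k ∈ Finset.range (n ^ 2), a k| + ∑ k ∈ Finset.Ico (n ^ 2) ((n + 1) ^ 2), |a k| :=
    calc |∑ k ∈ Finset.range N, a k|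
        = |∑ k ∈ Finset.range (n ^ 2), a k + ∑ k ∈ Finset.Ico (n ^ 2) N, a k| := by
          rw [Finset.sum_range_add_sum_Ico a hn_le]
      _ ≤ |∑ k ∈ Finset.range (n ^ 2), a k| + ∑ k ∈ Finset.Ico (n ^ 2) N, |a k| :=
          (abs_add_le _ _).trans (by gcongr; exact Finset.abs_sum_le_sum_abs _ _)
      _ ≤ _ := by gcongr
  rw [norm_div, Real.norm_eq_abs, Real.norm_natCast, abs_div, abs_of_pos hn_pos, ← add_div]
  gcongr
  exact_mod_cast hn_le

variable {Ω ι : Type*} [MeasurableSpace Ω] {μ : Measure Ω}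

theorem ae_tendsto_zero_of_summable_integral_sq {Y : ℕ → Ω → ℝ}
    (hint : ∀ n, Integrable (fun ω => Y n ω ^ 2) μ)
    (hsum : Summable fun n => ∫ ω, Y n ω ^ 2 ∂μ) :
    ∀ᵐ ω ∂μ, Tendsto (fun n => Y n ω) atTop (𝓝 0) := by
  have hfin : ∑' n, eLpNorm (fun ω => Y n ω ^ 2) 1 μ ≠ ⊤ := by
    simp_rw [eLpNorm_one_eq_lintegral_enorm, ← ofReal_integral_norm_eq_lintegral_enorm (hint _),
      norm_pow, Real.norm_eq_abs, sq_abs]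
    exact hsum.tsum_ofReal_ne_top
  filter_upwards [summable_norm_of_tsum_eLpNorm_ne_top le_rfl
    (fun n => (hint n).aestronglyMeasurable) hfin] with ω hω
  have hsq : Tendsto (fun n => Y n ω ^ 2) atTop (𝓝 0) := hω.of_norm.tendsto_atTop_zero
  rw [tendsto_zero_iff_abs_tendsto_zero]
  simpa only [Function.comp_def, Real.sqrt_sq_eq_abs, Real.sqrt_zero] using hsq.sqrt

theorem ae_tendsto_div_sq_of_integral_sq_le {Y : ℕ → Ω → ℝ} {K : ℝ} (hY : ∀ n, MemLp (Y n) 2 μ)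
    (hK : ∀ n, ∫ ω, Y n ω ^ 2 ∂μ ≤ K * ((n : ℝ) + 1) ^ 2) :
    ∀ᵐ ω ∂μ, Tendsto (fun n : ℕ => Y n ω / (n : ℝ) ^ 2) atTop (𝓝 0) := by
  refine ae_tendsto_zero_of_summable_integral_sq (fun n => ?_) ?_
  · simp_rw [div_pow]
    exact (hY n).integrable_sq.div_const _
  · have hK_nonneg : 0 ≤ K := by
      simpa using (integral_nonneg fun ω => sq_nonneg (Y 0 ω)).trans (hK 0)
    have hsum : Summable fun n : ℕ => 4 * K * (1 / (n : ℝ) ^ 2) :=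
      (Real.summable_one_div_nat_pow.2 one_lt_two).mul_left _
    refine hsum.of_nonneg_of_le (fun n => integral_nonneg fun ω => sq_nonneg _) fun n => ?_
    simp_rw [div_pow, integral_div]
    rcases n.eq_zero_or_pos with rfl | hn
    · simp
    · have hn_one : (1 : ℝ) ≤ n := by exact_mod_cast hn
      rw [div_le_iff₀ (by positivity)]
      calc ∫ ω, Y n ω ^ 2 ∂μ ≤ K * ((n : ℝ) + 1) ^ 2 := hK n
        _ ≤ K * (2 * (n : ℝ)) ^ 2 := by gcongr; linarith
        _ = 4 * K * (1 / (n : ℝ) ^ 2) * ((n : ℝ) ^ 2) ^ 2 := by field_simp; ring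

theorem integral_sq_sum_of_orthogonal {Z : ι → Ω → ℝ} (hZ : ∀ i, MemLp (Z i) 2 μ)
    (horth : Pairwise fun i j => ∫ ω, Z i ω * Z j ω ∂μ = 0) (s : Finset ι) :
    ∫ ω, (∑ i ∈ s, Z i ω) ^ 2 ∂μ = ∑ i ∈ s, ∫ ω, Z i ω ^ 2 ∂μ := by
  have hint : ∀ i j, Integrable (fun ω => Z i ω * Z j ω) μ := fun i j =>
    (hZ i).integrable_mul (hZ j)
  simp_rw [sq, Finset.sum_mul_sum]
  rw [integral_finsetSum s fun i _ => integrable_finsetSum s fun j _ => hint i j]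
  refine Finset.sum_congr rfl fun i hi => ?_
  rw [integral_finsetSum s fun j _ => hint i j]
  exact Finset.sum_eq_single_of_mem i hi fun j _ hj => horth hj.symm

theorem integral_sq_sum_abs_le {Z : ι → Ω → ℝ} (hZ : ∀ i, MemLp (Z i) 2 μ) (s : Finset ι) :
    ∫ ω, (∑ i ∈ s, |Z i ω|) ^ 2 ∂μ ≤ s.card * ∑ i ∈ s, ∫ ω, Z i ω ^ 2 ∂μ := by
  rw [← integral_finsetSum s fun i _ => (hZ i).integrable_sq, ← integral_const_mul]
  refine integral_mono (memLp_finsetSum s fun i _ => (hZ i).abs).integrable_sq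
    ((integrable_finsetSum s fun i _ => (hZ i).integrable_sq).const_mul _) fun ω => ?_
  simpa only [sq_abs] using sq_sum_le_card_mul_sum_sq (s := s) (f := fun i => |Z i ω|)

theorem strong_law_ae_of_orthogonal {Z : ℕ → Ω → ℝ} {K : ℝ} (hZ : ∀ k, MemLp (Z k) 2 μ)
    (horth : Pairwise fun i j => ∫ ω, Z i ω * Z j ω ∂μ = 0)
    (hK : ∀ k, ∫ ω, Z k ω ^ 2 ∂μ ≤ K) :
    ∀ᵐ ω ∂μ, Tendsto (fun N : ℕ => (∑ k ∈ Finset.range N, Z k ω) / N) atTop (𝓝 0) := by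
  have hK_nonneg : 0 ≤ K := (integral_nonneg fun ω => sq_nonneg (Z 0 ω)).trans (hK 0)
  have hsum : ∀ s : Finset ℕ, ∑ k ∈ s, ∫ ω, Z k ω ^ 2 ∂μ ≤ s.card * K := fun s => by
    simpa using Finset.sum_le_card_nsmul s _ K fun k _ => hK k
  have hsq : ∀ᵐ ω ∂μ, Tendsto
      (fun n : ℕ => (∑ k ∈ Finset.range (n ^ 2), Z k ω) / (n : ℝ) ^ 2) atTop (𝓝 0) := by
    refine ae_tendsto_div_sq_of_integral_sq_le (K := K)
      (fun n => memLp_finsetSum _ fun k _ => hZ k) fun n => ?_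
    rw [integral_sq_sum_of_orthogonal hZ horth]
    refine (hsum _).trans ?_
    rw [Finset.card_range, Nat.cast_pow, mul_comm]
    gcongr
    exact le_add_of_nonneg_right zero_le_one
  have hgap : ∀ᵐ ω ∂μ, Tendsto
      (fun n : ℕ => (∑ k ∈ Finset.Ico (n ^ 2) ((n + 1) ^ 2), |Z k ω|) / (n : ℝ) ^ 2)
      atTop (𝓝 0) := by
    refine ae_tendsto_div_sq_of_integral_sq_le (K := 4 * K)
      (fun n => memLp_finsetSum _ fun k _ => (hZ k).abs) fun n => ?_
    have hcard : (Finset.Ico (n ^ 2) ((n + 1) ^ 2)).card = 2 * n + 1 := by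
      rw [Nat.card_Ico, Nat.sub_eq_iff_eq_add (by gcongr; omega)]
      ring
    calc ∫ ω, (∑ k ∈ Finset.Ico (n ^ 2) ((n + 1) ^ 2), |Z k ω|) ^ 2 ∂μ
        ≤ (2 * n + 1 : ℕ) * ((2 * n + 1 : ℕ) * K) := by
          rw [← hcard]
          exact (integral_sq_sum_abs_le hZ _).trans (by gcongr; exact hsum _)
      _ ≤ (2 * (n + 1) : ℕ) * ((2 * (n + 1) : ℕ) * K) := by gcongr <;> omega
      _ = 4 * K * ((n : ℝ) + 1) ^ 2 := by push_cast; ring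
  filter_upwards [hsq, hgap] with ω hωsq hωgap
  exact tendsto_average_of_tendsto_squares hωsq hωgap

end OrthogonalStrongLaw

/-- The event that the process `X` follows the path `x` up to time `n`. -/
def pathEvent {Ω S : Type*} (X : ℕ → Ω → S) (n : ℕ) (x : ℕ → S) : Set Ω :=
  ⋂ i ∈ Set.Iic n, X i ⁻¹' {x i}

theorem mem_pathEvent {Ω S : Type*} {X : ℕ → Ω → S} {n : ℕ} {x : ℕ → S} {ω : Ω} :
    ω ∈ pathEvent X n x ↔ ∀ i ∈ Set.Iic n, X i ω = x i := by
  simp only [pathEvent, Set.mem_iInter, Set.mem_preimage, Set.mem_singleton_iff]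

/-- The martingale increment `h (x (n + 1)) - E[h (X (n + 1)) | X n = x n]` of the function `h`
along the path `x` of a Markov chain `X` with column-stochastic transition matrix `P`. -/
def martingaleIncrement {S : Type*} [Fintype S] (P : Matrix S S ℝ) (h : S → ℝ) (n : ℕ)
    (x : ℕ → S) : ℝ :=
  h (x (n + 1)) - (Matrix.vecMul h P) (x n)

theorem norm_martingaleIncrement_le {S : Type*} [Fintype S] (P : Matrix S S ℝ) (h : S → ℝ)
    (n : ℕ) (x : ℕ → S) : ‖martingaleIncrement P h n x‖ ≤ ‖h‖ + ‖Matrix.vecMul h P‖ :=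
  (norm_sub_le _ _).trans (add_le_add (norm_le_pi_norm _ _) (norm_le_pi_norm _ _))

theorem dependsOn_martingaleIncrement {S : Type*} [Fintype S] (P : Matrix S S ℝ) (h : S → ℝ)
    {i j : ℕ} (hij : i < j) : DependsOn (martingaleIncrement P h i) (Set.Iic j) := fun x y hxy => by
  rw [martingaleIncrement, martingaleIncrement, hxy i hij.le, hxy (i + 1) hij]

theorem sum_range_sub_vecMul {S : Type*} [Fintype S] (P : Matrix S S ℝ) (h : S → ℝ) (x : ℕ → S)
    (N : ℕ) :
    ∑ k ∈ Finset.range N, (h - Matrix.vecMul h P) (x k) =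
      h (x 0) - h (x N) + ∑ k ∈ Finset.range N, martingaleIncrement P h k x := by
  rw [← Finset.sum_range_sub' (fun k => h (x k)), ← Finset.sum_add_distrib]
  refine Finset.sum_congr rfl fun k _ => ?_
  rw [martingaleIncrement, Pi.sub_apply]
  ring

theorem tendsto_sub_div_atTop_zero {S : Type*} [Finite S] (h : S → ℝ) (x : ℕ → S) :
    Tendsto (fun N : ℕ => (h (x 0) - h (x N)) / N) atTop (𝓝 0) := by
  have := Fintype.ofFinite S
  refine squeeze_zero_norm (fun N => ?_)
    (tendsto_natCast_atTop_atTop.const_div_atTop (‖h‖ + ‖h‖))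
  rw [norm_div, Real.norm_natCast]
  gcongr
  exact (norm_sub_le _ _).trans (add_le_add (norm_le_pi_norm h _) (norm_le_pi_norm h _))

section FiniteValuedProcess

variable {Ω S : Type*} [MeasurableSpace Ω] {μ : Measure Ω} [MeasurableSpace S]
  [MeasurableSingletonClass S]

theorem measurableSet_pathEvent {X : ℕ → Ω → S} (hX : ∀ n, Measurable (X n)) (n : ℕ)
    (x : ℕ → S) : MeasurableSet (pathEvent X n x) :=
  MeasurableSet.biInter (Set.to_countable _) fun i _ => hX i (measurableSet_singleton _)

theorem integral_eq_zero_of_setIntegral_pathEvent_eq_zero [Finite S] {X : ℕ → Ω → S}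
    (hX : ∀ n, Measurable (X n)) (n : ℕ) {f : Ω → ℝ}
    (hf : ∀ x, ∫ ω in pathEvent X n x, f ω ∂μ = 0) : ∫ ω, f ω ∂μ = 0 := by
  by_cases hint : Integrable f μ
  swap
  · exact integral_undef hint
  have := Fintype.ofFinite (Set.Iic n → S)
  let past : Ω → Set.Iic n → S := fun ω i => X i ω
  have hpast : Measurable past := measurable_pi_lambda _ fun i => hX i
  have hcover : ⋃ y, past ⁻¹' {y} = Set.univ := by
    rw [← Set.preimage_iUnion, Set.iUnion_of_singleton, Set.preimage_univ]
  rw [← setIntegral_univ, ← hcover, integral_iUnion_fintype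
    (fun y => hpast (measurableSet_singleton y)) (pairwise_disjoint_fiber past)
    fun y => hint.integrableOn]
  refine Finset.sum_eq_zero fun y _ => ?_
  rcases (past ⁻¹' {y}).eq_empty_or_nonempty with hempty | ⟨ω₀, rfl⟩
  · rw [hempty, setIntegral_empty]
  · have hfiber : past ⁻¹' {past ω₀} = pathEvent X n (X · ω₀) := by
      ext ω
      simp only [mem_pathEvent, Set.mem_preimage, Set.mem_singleton_iff, funext_iff,
        Subtype.forall, past]
    rw [hfiber, hf]

theorem memLp_comp_of_finite [Finite S] [IsFiniteMeasure μ] (q : ENNReal) {Y : Ω → S}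
    (hY : Measurable Y) (f : S → ℝ) : MemLp (fun ω => f (Y ω)) q μ := by
  have := Fintype.ofFinite S
  exact MemLp.of_bound ((measurable_of_finite f).comp hY).aestronglyMeasurable ‖f‖
    (ae_of_all _ fun ω => norm_le_pi_norm f (Y ω))

theorem integral_comp_eq_sum [Fintype S] [IsFiniteMeasure μ] {Y : Ω → S} (hY : Measurable Y)
    (f : S → ℝ) : ∫ ω, f (Y ω) ∂μ = ∑ s, μ.real (Y ⁻¹' {s}) * f s := by
  rw [← integral_map hY.aemeasurable (measurable_of_finite f).aestronglyMeasurable,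
    integral_fintype Integrable.of_finite]
  simp only [map_measureReal_apply hY (measurableSet_singleton _), smul_eq_mul]

end FiniteValuedProcess

namespace IsMarkovChain

open Matrix

variable {Ω S : Type*} [MeasurableSpace Ω] {μ : Measure Ω} [IsFiniteMeasure μ]
  [Fintype S] [DecidableEq S] [MeasurableSpace S] [MeasurableSingletonClass S]
  {X : ℕ → Ω → S} {lam : S → ℝ} {P : Matrix S S ℝ}

theorem measureReal_pathEvent_inter (hX : IsMarkovChain μ X lam P) (n : ℕ) (x : ℕ → S) (r : S) :
    μ.real (pathEvent X n x ∩ X (n + 1) ⁻¹' {r}) = P r (x n) * μ.real (pathEvent X n x) := by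
  by_cases hnull : μ (pathEvent X n x) = 0
  · rw [Measure.real, Measure.real, measure_inter_null_of_null_left _ hnull, hnull,
      ENNReal.toReal_zero, mul_zero]
  have hn : μ (X n ⁻¹' {x n}) ≠ 0 := fun h =>
    hnull (measure_mono_null (Set.biInter_subset_of_mem Set.self_mem_Iic) h)
  have hcond : (cond μ (pathEvent X n x)).real (X (n + 1) ⁻¹' {r}) = P r (x n) := by
    have hupdate : pathEvent X n (Function.update x (n + 1) r) = pathEvent X n x :=
      Set.iInter₂_congr fun i hi => by
        rw [Function.update_of_ne (Nat.lt_succ_of_le hi).ne]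
    have hmarkov := hX.markov n (Function.update x (n + 1) r)
    rw [← pathEvent, hupdate, Function.update_self,
      Function.update_of_ne n.lt_succ_self.ne] at hmarkov
    exact (hmarkov hnull).trans (hX.transition n r (x n) hn)
  rw [← hcond, Measure.real, Measure.real, Measure.real, ← ENNReal.toReal_mul,
    cond_mul_eq_inter (measurableSet_pathEvent hX.measurable n x)]

theorem setIntegral_pathEvent_comp_succ (hX : IsMarkovChain μ X lam P) (h : S → ℝ) (n : ℕ)
    (x : ℕ → S) :
    ∫ ω in pathEvent X n x, h (X (n + 1) ω) ∂μ = μ.real (pathEvent X n x) * (h ᵥ* P) (x n) := by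
  rw [integral_comp_eq_sum (hX.measurable (n + 1)), vecMul, dotProduct, Finset.mul_sum]
  refine Finset.sum_congr rfl fun r _ => ?_
  rw [measureReal_restrict_apply (hX.measurable (n + 1) (measurableSet_singleton r)),
    Set.inter_comm, hX.measureReal_pathEvent_inter]
  ring

theorem memLp_martingaleIncrement (hX : IsMarkovChain μ X lam P) (q : ENNReal) (h : S → ℝ)
    (n : ℕ) : MemLp (fun ω => martingaleIncrement P h n (X · ω)) q μ :=
  (memLp_comp_of_finite q (hX.measurable (n + 1)) h).sub
    (memLp_comp_of_finite q (hX.measurable n) (h ᵥ* P))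

theorem setIntegral_pathEvent_martingaleIncrement (hX : IsMarkovChain μ X lam P) (h : S → ℝ)
    (n : ℕ) (x : ℕ → S) :
    ∫ ω in pathEvent X n x, martingaleIncrement P h n (X · ω) ∂μ = 0 := by
  have hpresent : ∫ ω in pathEvent X n x, (h ᵥ* P) (X n ω) ∂μ =
      μ.real (pathEvent X n x) * (h ᵥ* P) (x n) := by
    rw [setIntegral_congr_fun (g := fun _ => (h ᵥ* P) (x n))
      (measurableSet_pathEvent hX.measurable n x)
      fun ω hω => congrArg (h ᵥ* P) (mem_pathEvent.1 hω n Set.self_mem_Iic),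
      setIntegral_const, smul_eq_mul]
  simp only [martingaleIncrement]
  rw [integral_sub ((memLp_comp_of_finite 1 (hX.measurable (n + 1)) h).integrable le_rfl)
    ((memLp_comp_of_finite 1 (hX.measurable n) (h ᵥ* P)).integrable le_rfl),
    hX.setIntegral_pathEvent_comp_succ, hpresent, sub_self]

theorem integral_mul_martingaleIncrement (hX : IsMarkovChain μ X lam P) (h : S → ℝ) {n : ℕ}
    {F : (ℕ → S) → ℝ} (hF : DependsOn F (Set.Iic n)) :
    ∫ ω, F (X · ω) * martingaleIncrement P h n (X · ω) ∂μ = 0 := by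
  refine integral_eq_zero_of_setIntegral_pathEvent_eq_zero hX.measurable n fun x => ?_
  rw [setIntegral_congr_fun (g := fun ω => F x * martingaleIncrement P h n (X · ω))
    (measurableSet_pathEvent hX.measurable n x)
    fun ω hω => congrArg (· * _) (hF (mem_pathEvent.1 hω)),
    integral_const_mul, hX.setIntegral_pathEvent_martingaleIncrement, mul_zero]

theorem pairwise_integral_martingaleIncrement_mul_eq_zero (hX : IsMarkovChain μ X lam P)
    (h : S → ℝ) : Pairwise fun i j =>
      ∫ ω, martingaleIncrement P h i (X · ω) * martingaleIncrement P h j (X · ω) ∂μ = 0 := by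
  intro i j hij
  rcases hij.lt_or_gt with hlt | hgt
  · exact hX.integral_mul_martingaleIncrement h (dependsOn_martingaleIncrement P h hlt)
  · simpa only [mul_comm] using
      hX.integral_mul_martingaleIncrement h (dependsOn_martingaleIncrement P h hgt)

theorem ae_tendsto_average_martingaleIncrement (hX : IsMarkovChain μ X lam P) (h : S → ℝ) :
    ∀ᵐ ω ∂μ, Tendsto (fun N : ℕ =>
      (∑ k ∈ Finset.range N, martingaleIncrement P h k (X · ω)) / N) atTop (𝓝 0) := by
  refine strong_law_ae_of_orthogonal (K := μ.real Set.univ * (‖h‖ + ‖h ᵥ* P‖) ^ 2)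
    (hX.memLp_martingaleIncrement 2 h) (hX.pairwise_integral_martingaleIncrement_mul_eq_zero h)
    fun k => ?_
  rw [← smul_eq_mul, ← integral_const]
  refine integral_mono (hX.memLp_martingaleIncrement 2 h k).integrable_sq (integrable_const _)
    fun ω => ?_
  rw [← sq_abs, ← Real.norm_eq_abs]
  exact pow_le_pow_left₀ (norm_nonneg _) (norm_martingaleIncrement_le P h k _) 2

theorem ae_tendsto_average (hX : IsMarkovChain μ X lam P) (hirr : P.IsIrreducible) {p : S → ℝ}
    (hp : IsStationaryDistribution P p) (f : S → ℝ) :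
    ∀ᵐ ω ∂μ, Tendsto (fun N : ℕ => (∑ k ∈ Finset.range N, f (X k ω)) / N) atTop
      (𝓝 (f ⬝ᵥ p)) := by
  obtain ⟨h, hh⟩ := hp.exists_sub_vecMul_eq hX.stochastic hirr f
  filter_upwards [hX.ae_tendsto_average_martingaleIncrement h] with ω hω
  have hlim := ((tendsto_sub_div_atTop_zero h (X · ω)).add hω).add_const (f ⬝ᵥ p)
  rw [add_zero, zero_add] at hlim
  refine hlim.congr' ?_
  filter_upwards [eventually_ne_atTop 0] with N hN
  have hpoisson : ∑ k ∈ Finset.range N, f (X k ω) - N * (f ⬝ᵥ p) =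
      h (X 0 ω) - h (X N ω) + ∑ k ∈ Finset.range N, martingaleIncrement P h k (X · ω) := by
    have hsum := sum_range_sub_vecMul P h (X · ω) N
    rw [hh] at hsum
    simpa using hsum
  rw [← add_div, ← hpoisson]
  field_simp
  ring

theorem ae_tendsto_frequency (hX : IsMarkovChain μ X lam P) (hirr : P.IsIrreducible)
    {p : S → ℝ} (hp : IsStationaryDistribution P p) (A : Finset S) :
    ∀ᵐ ω ∂μ, Tendsto (fun N : ℕ => (∑ k ∈ Finset.range N, if X k ω ∈ A then (1 : ℝ) else 0) / N)
      atTop (𝓝 (∑ s ∈ A, p s)) := by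
  simpa [dotProduct] using hX.ae_tendsto_average hirr hp fun s => if s ∈ A then 1 else 0

end IsMarkovChain

namespace PeriodicTask

theorem DMR_eq_sum_ite_div {S : Type*} [DecidableEq S] {τ : PeriodicTask}
    {B : SupplyFunction τ.T} {c : ℕ → ℝ} {x : ℕ → S} {A : Finset S}
    (hA : ∀ j, x j ∈ A ↔ τ.Misses B c j) (N : ℕ) :
    τ.DMR B c N = (∑ j ∈ Finset.range N, if x j ∈ A then (1 : ℝ) else 0) / N := by
  simp only [DMR, DM, ← hA, one_div_mul_eq_div]

theorem IsDeadlineMissRate.iff_eq {Ω : Type*} [MeasurableSpace Ω] {μ : Measure Ω} [NeZero μ]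
    {τ : PeriodicTask} {B : Ω → SupplyFunction τ.T} {C : ℕ → Ω → ℝ} {d e : ℝ}
    (hd : τ.IsDeadlineMissRate μ B C d) : τ.IsDeadlineMissRate μ B C e ↔ e = d := by
  refine ⟨fun he => ?_, fun he => he ▸ hd⟩
  obtain ⟨ω, hωe, hωd⟩ := (he.and hd).exists
  exact tendsto_nhds_unique hωe hωd

end PeriodicTask

theorem corollary1 {Ω S : Type*} [MeasurableSpace Ω] (μ : Measure Ω) [IsProbabilityMeasure μ]
    [Fintype S] [DecidableEq S] [MeasurableSpace S] [MeasurableSingletonClass S]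
    (τ : PeriodicTask) (B : Ω → SupplyFunction τ.T) (C : ℕ → Ω → ℝ)
    (X : ℕ → Ω → S) (lam : S → ℝ) (P : Matrix S S ℝ)
    (hX : IsMarkovChain μ X lam P) (hP : P.IsIrreducible)
    (SDM : Finset S)
    (hSDM : ∀ j, ∀ᵐ ω ∂μ, X j ω ∈ SDM ↔ τ.Misses (B ω) (fun i => C i ω) j) :
    ∃ p : S → ℝ, IsStationaryDistribution P p ∧
      (∀ q : S → ℝ, IsStationaryDistribution P q → q = p) ∧
      (∀ᵐ ω ∂μ, Tendsto (fun N => τ.DMR (B ω) (fun j => C j ω) N) atTop (𝓝 (∑ s ∈ SDM, p s))) ∧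
      (∀ d : ℝ, τ.IsDeadlineMissRate μ B C d ↔ d = ∑ s ∈ SDM, p s) := by
  have : Nonempty S := (nonempty_of_isProbabilityMeasure μ).map (X 0)
  obtain ⟨p, hp⟩ := exists_isStationaryDistribution hX.stochastic
  have hlim : τ.IsDeadlineMissRate μ B C (∑ s ∈ SDM, p s) := by
    filter_upwards [hX.ae_tendsto_frequency hP hp SDM, ae_all_iff.2 hSDM] with ω hfreq hmiss
    refine hfreq.congr fun N => ?_
    rw [PeriodicTask.DMR_eq_sum_ite_div hmiss]
  exact ⟨p, hp, fun q hq => hp.eq_of_isIrreducible hX.stochastic hP hq, hlim, fun d => hlim.iff_eq⟩
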